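/- Let $n,d\ge 1$, let $a_1,\dots,a_n\in\mathbb R^d$ and $\hat f_1,\dots,\hat f_n:\mathbb R\to\mathbb R$, and put $f_j(x)=\hat f_j(a_j^\top x)$ and $f(x)=\frac1n\sum_{j=1}^n f_j(x)$ for $x\in\mathbb R^d$. Assume that $f$ is convex and twice differentiable, that each $f_j$ (possibly nonconvex) is twice differentiable, and that there are constants $0<L_j,\rho_j<\infty$ with $$\|\nabla f_j(x)-\nabla f_j(y)\|\le L_j\|x-y\|,\qquad \|\nabla^2 f_j(x)-\nabla^2 f_j(y)\|\le \rho_j\|x-y\|\qquad\text{for all }x,y\in\mathbb R^d,$$ where $\|\cdot\|$ is the Euclidean norm of vectors and the spectral norm of matrices. Put $L=\max_j L_j$ and $\bar L=\frac1n\sum_{j=1}^n L_j$. Fix $x\in\mathbb R^d$ and set $$p_j=\frac{|\hat f_j''(a_j^\top x)|\,\|a_j\|^2}{\sum_{k=1}^n|\hat f_k''(a_k^\top x)|\,\|a_k\|^2},\qquad \mathcal N=\{j:\hat f_j''(a_j^\top x)\ne 0\},\qquad p_{\min}=\min_{j\in\mathcal N}p_j ,$$ and assume that $p_{\min}$ is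 well defined and positive (that is, $\mathcal N\neq\emptyset$ and $a_j\ne0$ for every $j\in\mathcal N$). Let $\mathcal S$ be a collection of $|\mathcal S|$ indices drawn independently with replacement from $\{1,\dots,n\}$, each equal to $j$ with probability $p_j$, and let $$H(x)=\frac{1}{n|\mathcal S|}\sum_{j\in\mathcal S}\frac1{p_j}\nabla^2 f_j(x),$$ where repeated indices are counted with multiplicity. Let $0<\epsilon,\delta<1$. If $$|\mathcal S|\ \ge\ \max\left\{\frac{4\bar L^2}{\epsilon^2},\ \frac{2L}{\epsilon}\cdot\frac{n+1/p_{\min}-2}{n}\right\}\cdot\log\left(\frac{2d}{\delta}\right),$$ then $$\mathbb P\left(\|H(x)-\nabla^2 f(x)\|\ge\epsilon\right)<\delta .$$ -/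

import Mathlib

namespace SubsampledHessian

noncomputable section

/-- The objective `f(x) = (1/n) ∑ⱼ fⱼ(x)` of a finite-sum problem on `ℝᵈ`. -/
def objective {n d : ℕ} (F : Fin n → EuclideanSpace ℝ (Fin d) → ℝ)
    (x : EuclideanSpace ℝ (Fin d)) : ℝ :=
  (1 / (n : ℝ)) * ∑ j, F j x

/-- The Hessian of `f` at `x`: the derivative of the gradient field, an operator on `ℝᵈ`.
The operator norm for the Euclidean norm is the spectral norm. -/
def hessian {d : ℕ} (f : EuclideanSpace ℝ (Fin d) → ℝ) (x : EuclideanSpace ℝ (Fin d)) :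
    EuclideanSpace ℝ (Fin d) →L[ℝ] EuclideanSpace ℝ (Fin d) :=
  fderiv ℝ (gradient f) x

/-- `f` is twice differentiable on `ℝᵈ`. -/
def TwiceDifferentiable {d : ℕ} (f : EuclideanSpace ℝ (Fin d) → ℝ) : Prop :=
  Differentiable ℝ f ∧ Differentiable ℝ (gradient f)

/-- The standing assumption on a finite-sum problem: the objective is convex and twice
differentiable; each component (possibly nonconvex) is twice differentiable, with gradient and
Hessian Lipschitz continuous with constants `Lⱼ > 0` and `ρⱼ > 0`. -/
structure SmoothFiniteSum {n d : ℕ} (F : Fin n → EuclideanSpace ℝ (Fin d) → ℝ)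
    (L ρ : Fin n → ℝ) : Prop where
  convex : ConvexOn ℝ Set.univ (objective F)
  twiceDifferentiable : TwiceDifferentiable (objective F)
  component_twiceDifferentiable : ∀ j, TwiceDifferentiable (F j)
  L_pos : ∀ j, 0 < L j
  rho_pos : ∀ j, 0 < ρ j
  gradient_lipschitz : ∀ j x y, ‖gradient (F j) x - gradient (F j) y‖ ≤ L j * ‖x - y‖
  hessian_lipschitz : ∀ j x y, ‖hessian (F j) x - hessian (F j) y‖ ≤ ρ j * ‖x - y‖

/-- The components `fⱼ(x) = gⱼ(aⱼᵀ x)` of a generalized linear problem. -/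
def glm {n d : ℕ} (g : Fin n → ℝ → ℝ) (a : Fin n → EuclideanSpace ℝ (Fin d))
    (j : Fin n) (x : EuclideanSpace ℝ (Fin d)) : ℝ :=
  g j (inner ℝ (a j) x)

/-- The second derivative `gⱼ''(aⱼᵀ x)`. -/
def secondDeriv {n d : ℕ} (g : Fin n → ℝ → ℝ) (a : Fin n → EuclideanSpace ℝ (Fin d))
    (x : EuclideanSpace ℝ (Fin d)) (j : Fin n) : ℝ :=
  deriv (deriv (g j)) (inner ℝ (a j) x)

/-- The non-uniform sampling probabilities
`pⱼ = |gⱼ''(aⱼᵀ x)| ‖aⱼ‖² / ∑ₖ |gₖ''(aₖᵀ x)| ‖aₖ‖²`. -/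
def samplingProb {n d : ℕ} (g : Fin n → ℝ → ℝ) (a : Fin n → EuclideanSpace ℝ (Fin d))
    (x : EuclideanSpace ℝ (Fin d)) (j : Fin n) : ℝ :=
  |secondDeriv g a x j| * ‖a j‖ ^ 2 / ∑ k, |secondDeriv g a x k| * ‖a k‖ ^ 2

/-- `p_min`, the minimum of `pⱼ` over the indices with `gⱼ''(aⱼᵀ x) ≠ 0`. The infimum is over a
finite set, so it is a minimum when there is such an index; it is `0` when there is none. -/
def pMin {n d : ℕ} (g : Fin n → ℝ → ℝ) (a : Fin n → EuclideanSpace ℝ (Fin d))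
    (x : EuclideanSpace ℝ (Fin d)) : ℝ :=
  ⨅ j : {j : Fin n // secondDeriv g a x j ≠ 0}, samplingProb g a x j

/-- The sub-sampled Hessian `H(x) = (1 / (n |S|)) ∑_{j ∈ S} (1 / pⱼ) ∇²fⱼ(x)` for the sample
collection `S = (s 0, …, s (m - 1))`, repetitions allowed, `|S| = m`. -/
def subsampledHessian {n d m : ℕ} (F : Fin n → EuclideanSpace ℝ (Fin d) → ℝ) (p : Fin n → ℝ)
    (s : Fin m → Fin n) (x : EuclideanSpace ℝ (Fin d)) :
    EuclideanSpace ℝ (Fin d) →L[ℝ] EuclideanSpace ℝ (Fin d) :=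
  (1 / ((n : ℝ) * (m : ℝ))) • ∑ k, (1 / p (s k)) • hessian (F (s k)) x

/-- `L = maxⱼ Lⱼ`. -/
def maxConst {n : ℕ} (L : Fin n → ℝ) : ℝ := ⨆ j, L j

/-- `L̄ = (1/n) ∑ⱼ Lⱼ`. -/
def avgConst {n : ℕ} (L : Fin n → ℝ) : ℝ := (1 / (n : ℝ)) * ∑ j, L j

end

end SubsampledHessian

/-! Put `Y j = ∇²fⱼ(x) / (n pⱼ)`. Indices with `pⱼ = 0` have zero Hessian, so `Y` has mean `∇²f(x)`
under `p`, and `H(x)` is an empirical mean of i.i.d. self-adjoint operators. Matrix Bernstein then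
applies once `‖Y j‖` and `‖Y j - ∇²f(x)‖` are bounded.

Since `∇²fⱼ(x) = gⱼ''(aⱼᵀx) aⱼaⱼᵀ` has rank one, its norm is exactly the numerator of `pⱼ`. On the
support of `p` every `Y j` thus has the same norm, the average of the `‖∇²fₖ(x)‖`, at most `L̄`
(`norm_smul_hessian_glm_le`); so the variance is at most `L̄²`. Isolating the `j`-th Hessian in
`∇²f(x)` bounds the deviation (`norm_smul_hessian_glm_sub_le`), and
`mul_exp_neg_lt_of_le_sample_size` turns the tail into `δ`.

Bernstein is proved by the Laplace transform method: Golden–Thompson peels one summand at a time off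
`tr exp(θ ∑ X)`, which loses nothing in the exponent as all summands have the same law.
Golden–Thompson itself follows from `lie_trotter` and `trace_pow_two_pow_le`. -/

open Filter Topology NormedSpace

/-! ### The Lie–Trotter product formula. -/

section LieTrotter

variable {𝔸 : Type*} [NormedRing 𝔸] [NormOneClass 𝔸]

theorem norm_pow_sub_pow_le {x y : 𝔸} {M : ℝ} (hx : ‖x‖ ≤ M) (hy : ‖y‖ ≤ M) (hM : 1 ≤ M)
    (n : ℕ) : ‖x ^ n - y ^ n‖ ≤ n * M ^ n * ‖x - y‖ := by
  have hM0 : 0 ≤ M := zero_le_one.trans hM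
  induction n with
  | zero => simp
  | succ n ih =>
    have hsplit : x ^ (n + 1) - y ^ (n + 1) = (x ^ n - y ^ n) * x + y ^ n * (x - y) := by
      rw [pow_succ, pow_succ]; noncomm_ring
    have hyn : ‖y ^ n‖ ≤ M ^ (n + 1) :=
      (norm_pow_le y n).trans ((pow_le_pow_left₀ (norm_nonneg _) hy n).trans
        (pow_le_pow_right₀ hM n.le_succ))
    calc ‖x ^ (n + 1) - y ^ (n + 1)‖
        ≤ ‖x ^ n - y ^ n‖ * ‖x‖ + ‖y ^ n‖ * ‖x - y‖ := by
          rw [hsplit]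
          exact (norm_add_le _ _).trans (add_le_add (norm_mul_le _ _) (norm_mul_le _ _))
      _ ≤ (n * M ^ n * ‖x - y‖) * M + M ^ (n + 1) * ‖x - y‖ := by gcongr
      _ = ((n + 1 : ℕ) : ℝ) * M ^ (n + 1) * ‖x - y‖ := by push_cast; ring

variable [NormedAlgebra ℝ 𝔸]

theorem NormedSpace.norm_exp_le_exp_norm (x : 𝔸) : ‖exp x‖ ≤ Real.exp ‖x‖ := by
  rw [exp_eq_tsum ℝ, Real.exp_eq_exp_ℝ, exp_eq_tsum ℝ]
  have h : ∀ n : ℕ, ‖((n.factorial : ℝ)⁻¹) • x ^ n‖ ≤ ((n.factorial : ℝ)⁻¹) • ‖x‖ ^ n := by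
    intro n
    rw [norm_smul, Real.norm_of_nonneg (by positivity), smul_eq_mul]
    gcongr
    exact norm_pow_le x n
  exact tsum_of_norm_bounded (expSeries_summable' (𝕂 := ℝ) ‖x‖).hasSum h

theorem tendsto_inv_nat_nhdsNE : Tendsto (fun n : ℕ => (n : ℝ)⁻¹) atTop (𝓝[≠] 0) := by
  refine tendsto_nhdsWithin_iff.mpr ⟨tendsto_inv_atTop_nhds_zero_nat, ?_⟩
  filter_upwards [eventually_gt_atTop 0] with n hn
  simp [hn.ne']

/-- `D` vanishes to first order at `0`, so `n ‖D (1/n)‖ → 0`. Both bases have norm at most `exp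
(c/n)`, so their `n`-th powers differ by at most `exp c * n ‖D (1/n)‖`. -/
theorem lie_trotter [CompleteSpace 𝔸] (X Y : 𝔸) :
    Tendsto (fun n : ℕ => (exp ((n : ℝ)⁻¹ • X) * exp ((n : ℝ)⁻¹ • Y)) ^ n) atTop
      (𝓝 (exp (X + Y))) := by
  set D : ℝ → 𝔸 := fun t => exp (t • X) * exp (t • Y) - exp (t • (X + Y)) with hD
  have hderiv : HasDerivAt D 0 0 := by
    have hX := hasDerivAt_exp_smul_const (𝕂 := ℝ) X 0
    have hY := hasDerivAt_exp_smul_const (𝕂 := ℝ) Y 0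
    have hXY := hasDerivAt_exp_smul_const (𝕂 := ℝ) (X + Y) 0
    have h := (hX.mul hY).sub hXY
    refine HasDerivAt.congr_deriv (f := D) h ?_
    simp
  have hslope : Tendsto (fun n : ℕ => (n : ℝ) * ‖D (n : ℝ)⁻¹‖) atTop (𝓝 0) := by
    have h := ((hasDerivAt_iff_tendsto_slope.mp hderiv).comp tendsto_inv_nat_nhdsNE).norm
    rw [norm_zero] at h
    refine h.congr fun n => ?_
    have h0 : D 0 = 0 := by simp [hD]
    simp [slope, h0, norm_smul]
  set c : ℝ := ‖X‖ + ‖Y‖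
  have hc : 0 ≤ c := by positivity
  rw [tendsto_iff_norm_sub_tendsto_zero]
  have hlim : Tendsto (fun n : ℕ => Real.exp c * ((n : ℝ) * ‖D (n : ℝ)⁻¹‖)) atTop (𝓝 0) := by
    simpa using hslope.const_mul (Real.exp c)
  refine squeeze_zero' (Eventually.of_forall fun n => norm_nonneg _) ?_ hlim
  filter_upwards [eventually_gt_atTop 0] with n hn
  have hn0 : (n : ℝ) ≠ 0 := by positivity
  have hy : exp (X + Y) = exp ((n : ℝ)⁻¹ • (X + Y)) ^ n := by
    let : NormedAlgebra ℚ 𝔸 := NormedAlgebra.restrictScalars ℚ ℝ 𝔸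
    rw [← exp_nsmul, ← Nat.cast_smul_eq_nsmul ℝ, smul_smul, mul_inv_cancel₀ hn0, one_smul]
  have hsm : ∀ Z : 𝔸, ‖(n : ℝ)⁻¹ • Z‖ = (n : ℝ)⁻¹ * ‖Z‖ := fun Z => by
    rw [norm_smul, Real.norm_of_nonneg (by positivity)]
  have h1 : ‖exp ((n : ℝ)⁻¹ • X) * exp ((n : ℝ)⁻¹ • Y)‖ ≤ Real.exp ((n : ℝ)⁻¹ * c) := by
    refine (norm_mul_le _ _).trans ?_
    rw [mul_add, Real.exp_add, ← hsm, ← hsm]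
    gcongr <;> exact norm_exp_le_exp_norm _
  have h2 : ‖exp ((n : ℝ)⁻¹ • (X + Y))‖ ≤ Real.exp ((n : ℝ)⁻¹ * c) := by
    refine (norm_exp_le_exp_norm _).trans (Real.exp_le_exp.mpr ?_)
    rw [hsm]
    gcongr
    exact norm_add_le _ _
  have h := norm_pow_sub_pow_le h1 h2 (Real.one_le_exp (by positivity)) n
  rw [hy]
  refine h.trans (le_of_eq ?_)
  rw [← Real.exp_nat_mul, mul_inv_cancel_left₀ hn0]
  simp only [hD]
  ring

end LieTrotter

/-! ### Trace inequalities and Golden–Thompson. -/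

namespace Matrix

open scoped Matrix.Norms.L2Operator MatrixOrder

variable {ι : Type*} [Fintype ι]

theorem trace_mul_eq_sum (A B : Matrix ι ι ℝ) : (A * B).trace = ∑ i, ∑ j, A i j * B j i := by
  simp [trace, mul_apply]

/-- Cauchy–Schwarz for the Frobenius inner product. -/
theorem sq_trace_mul_le (A B : Matrix ι ι ℝ) :
    (A * B).trace ^ 2 ≤ (A * Aᵀ).trace * (Bᵀ * B).trace := by
  have h := Finset.sum_mul_sq_le_sq_mul_sq (Finset.univ : Finset (ι × ι))
    (fun q => A q.1 q.2) (fun q => B q.2 q.1)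
  simp only [Fintype.sum_prod_type] at h
  simp only [trace_mul_eq_sum, transpose_apply]
  simp only [pow_two] at h ⊢
  exact h.trans (le_of_eq (by rw [Finset.sum_comm (f := fun x y => B y x * B y x)]))

theorem trace_mul_transpose_self_nonneg (A : Matrix ι ι ℝ) : 0 ≤ (A * Aᵀ).trace := by
  rw [trace_mul_eq_sum]
  exact Finset.sum_nonneg fun i _ => Finset.sum_nonneg fun j _ => mul_self_nonneg (A i j)

theorem trace_mul_le_of_symm {P Q : Matrix ι ι ℝ} (hP : P.IsSymm) (hQ : Q.IsSymm)
    (h : (P * P).trace = (Q * Q).trace) : (P * Q).trace ≤ (Q * Q).trace := by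
  have h1 := sq_trace_mul_le P Q
  rw [hP.eq, hQ.eq, h, ← pow_two] at h1
  refine (le_abs_self _).trans (abs_le_of_sq_le_sq h1 ?_)
  have := trace_mul_transpose_self_nonneg Q
  rwa [hQ.eq] at this

theorem trace_mul_self_le (X : Matrix ι ι ℝ) : (X * X).trace ≤ (X * Xᵀ).trace := by
  have h1 := sq_trace_mul_le X X
  rw [trace_mul_comm Xᵀ X, ← pow_two] at h1
  exact (le_abs_self _).trans (abs_le_of_sq_le_sq h1 (trace_mul_transpose_self_nonneg X))

variable [DecidableEq ι]

theorem trace_mul_pow_comm (A B : Matrix ι ι ℝ) (n : ℕ) :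
    ((A * B) ^ n).trace = ((B * A) ^ n).trace := by
  cases n with
  | zero => simp
  | succ n =>
    rw [pow_succ, ← mul_assoc, trace_mul_comm, ← mul_assoc, ← mul_pow_mul, mul_assoc, ← pow_succ]

/-- The two claims feed each other in the induction. For the first, the second applied to `A * B`
produces `ABBA`, which is cyclically `A²B²`. For the second, `X²(Xᵀ)²` is cyclically `(XᵀX)(XXᵀ)`;
the first claim separates the two factors, whose powers have equal traces, and Cauchy–Schwarz merges
them. -/
theorem trace_pow_two_pow_le (k : ℕ) :
    (∀ A B : Matrix ι ι ℝ, A.IsSymm → B.IsSymm →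
      ((A * B) ^ 2 ^ k).trace ≤ (A ^ 2 ^ k * B ^ 2 ^ k).trace) ∧
    ∀ X : Matrix ι ι ℝ, (X ^ 2 ^ (k + 1)).trace ≤ ((X * Xᵀ) ^ 2 ^ k).trace := by
  induction k with
  | zero => exact ⟨fun A B _ _ => by simp, fun X => by simpa [pow_two] using trace_mul_self_le X⟩
  | succ k ih =>
    obtain ⟨ihG, ihC⟩ := ih
    have h2 : ∀ (A : Matrix ι ι ℝ) (r : ℕ), A ^ 2 ^ (r + 1) = (A * A) ^ 2 ^ r := fun A r => by
      rw [pow_succ', pow_mul, pow_two]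
    constructor
    · intro A B hA hB
      have hAA : (A * A).IsSymm := by rw [IsSymm, transpose_mul, hA.eq]
      have hBB : (B * B).IsSymm := by rw [IsSymm, transpose_mul, hB.eq]
      refine (ihC (A * B)).trans ?_
      rw [transpose_mul, hA.eq, hB.eq, ← mul_assoc, trace_mul_pow_comm, mul_assoc A B B,
        ← mul_assoc, h2 A, h2 B]
      exact ihG _ _ hAA hBB
    · intro X
      have hP : (Xᵀ * X).IsSymm := by rw [IsSymm, transpose_mul, transpose_transpose]
      have hQ : (X * Xᵀ).IsSymm := by rw [IsSymm, transpose_mul, transpose_transpose]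
      rw [h2 X]
      refine (ihC (X * X)).trans ?_
      rw [transpose_mul, mul_assoc, trace_mul_pow_comm, ← mul_assoc, mul_assoc (X * Xᵀ),
        trace_mul_pow_comm]
      refine (ihG _ _ hP hQ).trans ?_
      have hpow : ∀ Z : Matrix ι ι ℝ, Z ^ 2 ^ k * Z ^ 2 ^ k = Z ^ 2 ^ (k + 1) := fun Z => by
        rw [← pow_add, ← two_mul, ← pow_succ']
      rw [← hpow]
      refine trace_mul_le_of_symm (hP.pow _) (hQ.pow _) ?_
      rw [hpow, hpow, trace_mul_pow_comm]

variable [Nonempty ι]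

/-- The **Golden–Thompson inequality** for real symmetric matrices. -/
theorem golden_thompson {X Y : Matrix ι ι ℝ} (hX : X.IsSymm) (hY : Y.IsSymm) :
    (exp (X + Y)).trace ≤ (exp X * exp Y).trace := by
  have hcont : Continuous (fun M : Matrix ι ι ℝ => M.trace) := continuous_id.matrix_trace
  have hpow : Tendsto (fun k : ℕ => 2 ^ k) atTop atTop :=
    tendsto_pow_atTop_atTop_of_one_lt one_lt_two
  have hlim := (hcont.tendsto _).comp ((lie_trotter X Y).comp hpow)
  refine le_of_tendsto' hlim fun k => ?_
  have hn0 : ((2 ^ k : ℕ) : ℝ) ≠ 0 := by positivity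
  have hexp : ∀ Z : Matrix ι ι ℝ, exp ((((2 ^ k : ℕ) : ℝ))⁻¹ • Z) ^ 2 ^ k = exp Z := fun Z => by
    rw [← Matrix.exp_nsmul, ← Nat.cast_smul_eq_nsmul ℝ, smul_smul, mul_inv_cancel₀ hn0, one_smul]
  have h := (trace_pow_two_pow_le k).1 (exp ((((2 ^ k : ℕ) : ℝ))⁻¹ • X))
    (exp ((((2 ^ k : ℕ) : ℝ))⁻¹ • Y)) (hX.smul _).exp (hY.smul _).exp
  rw [hexp, hexp] at h
  exact h

end Matrix

/-! ### Scalar Bernstein bounds for the exponential. -/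

theorem Real.exp_le_one_add_add_sq_div {y : ℝ} (hy : |y| < 3) :
    Real.exp y ≤ 1 + y + y ^ 2 / 2 / (1 - |y| / 3) := by
  have hr : |y| / 3 < 1 := by linarith
  have hr0 : 0 ≤ |y| / 3 := by positivity
  have hgeom := (hasSum_geometric_of_lt_one hr0 hr).mul_left (y ^ 2 / 2)
  have hexp : HasSum (fun n : ℕ => y ^ n / (n.factorial : ℝ)) (Real.exp y) := by
    rw [Real.exp_eq_exp_ℝ]
    exact NormedSpace.expSeries_div_hasSum_exp y
  have htail : HasSum (fun n : ℕ => y ^ (n + 2) / ((n + 2).factorial : ℝ))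
      (Real.exp y - (1 + y)) := by
    have h := (hasSum_nat_add_iff' 2).mpr hexp
    simpa [Finset.sum_range_succ] using h
  have hle := hasSum_le (fun n : ℕ => ?_) htail hgeom
  · rw [← div_eq_mul_inv] at hle
    linarith
  -- This dominates the tail by a geometric series of ratio `|y| / 3`.
  · have hfac : (2 * 3 ^ n : ℝ) ≤ ((n + 2).factorial : ℝ) := by
      have h := @Nat.factorial_mul_pow_le_factorial 2 n
      rw [add_comm 2 n] at h
      exact_mod_cast h
    calc y ^ (n + 2) / ((n + 2).factorial : ℝ)
        ≤ |y| ^ (n + 2) / ((n + 2).factorial : ℝ) := by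
          refine div_le_div_of_nonneg_right ?_ (by positivity)
          rw [← abs_pow]
          exact le_abs_self _
      _ ≤ |y| ^ (n + 2) / (2 * 3 ^ n) := by gcongr
      _ = y ^ 2 / 2 * (|y| / 3) ^ n := by
          rw [← sq_abs y, div_pow, pow_add]; field_simp

theorem Real.exp_mul_le_of_abs_le {x R θ : ℝ} (hx : |x| ≤ R) (hθ : 0 ≤ θ) (hR : R * θ < 3) :
    Real.exp (θ * x) ≤ 1 + θ * x + θ ^ 2 / 2 / (1 - R * θ / 3) * x ^ 2 := by
  have habs : |θ * x| ≤ R * θ := by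
    rw [abs_mul, abs_of_nonneg hθ, mul_comm]; gcongr
  refine (Real.exp_le_one_add_add_sq_div (habs.trans_lt hR)).trans ?_
  have h1 : 0 < 1 - R * θ / 3 := by linarith
  have h2 : (θ * x) ^ 2 / 2 / (1 - |θ * x| / 3) ≤ (θ * x) ^ 2 / 2 / (1 - R * θ / 3) := by
    gcongr
  refine (add_le_add_right h2 _).trans (le_of_eq ?_)
  field_simp

/-! ### Operator inequalities from the functional calculus. -/

namespace Matrix

open scoped Matrix.Norms.L2Operator MatrixOrder

variable {ι : Type*} [Fintype ι] [DecidableEq ι]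

theorem exp_smul_le {A : Matrix ι ι ℝ} (hA : IsSelfAdjoint A) {R θ : ℝ} (hAR : ‖A‖ ≤ R)
    (hθ : 0 ≤ θ) (hR : R * θ < 3) :
    exp (θ • A) ≤ 1 + θ • A + (θ ^ 2 / 2 / (1 - R * θ / 3)) • (A * A) := by
  set c := θ ^ 2 / 2 / (1 - R * θ / 3)
  have h1 : exp (θ • A) = cfc (fun x : ℝ => Real.exp (θ * x)) A := by
    rw [← CFC.real_exp_eq_normedSpace_exp ((IsSelfAdjoint.all θ).smul hA),
      ← cfc_comp_smul θ Real.exp A]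
    rfl
  have h2 : 1 + θ • A + c • (A * A) = cfc (fun x : ℝ => 1 + θ * x + c * x ^ 2) A := by
    rw [cfc_add A (fun x : ℝ => 1 + θ * x) (fun x => c * x ^ 2),
      cfc_add A (fun _ : ℝ => (1 : ℝ)) (fun x => θ * x),
      cfc_const_mul_id θ A, cfc_const_mul c (fun x : ℝ => x ^ 2) A, cfc_pow_id A 2,
      cfc_const_one ℝ A, pow_two]
  rw [h1, h2]
  refine cfc_mono fun x hx => Real.exp_mul_le_of_abs_le ?_ hθ hR
  exact (IsometricContinuousFunctionalCalculus.norm_spectrum_le (𝕜 := ℝ) A hx).trans hAR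

theorem mul_self_le_smul_one {A : Matrix ι ι ℝ} (hA : IsSelfAdjoint A) {s : ℝ} (hAs : ‖A‖ ≤ s) :
    A * A ≤ s ^ 2 • (1 : Matrix ι ι ℝ) := by
  have h1 : A * A = cfc (fun x : ℝ => x ^ 2) A := by rw [cfc_pow_id A 2, pow_two]
  have h2 : s ^ 2 • (1 : Matrix ι ι ℝ) = cfc (fun _ : ℝ => s ^ 2) A := by
    rw [cfc_const (s ^ 2) A, Algebra.algebraMap_eq_smul_one]
  rw [h1, h2]
  refine cfc_mono fun x hx => ?_
  have h := (IsometricContinuousFunctionalCalculus.norm_spectrum_le (𝕜 := ℝ) A hx).trans hAs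
  rw [← sq_abs]
  exact pow_le_pow_left₀ (abs_nonneg x) h 2

/-- By cyclicity the trace is that of `√P Q √P`, which is positive semidefinite. -/
theorem PosSemidef.trace_mul_nonneg {P Q : Matrix ι ι ℝ} (hP : P.PosSemidef) (hQ : Q.PosSemidef) :
    0 ≤ (P * Q).trace := by
  have hB : (CFC.sqrt P)ᴴ = CFC.sqrt P := (nonneg_iff_posSemidef.mp (CFC.sqrt_nonneg P)).isHermitian
  have h := (hQ.mul_mul_conjTranspose_same (CFC.sqrt P)).trace_nonneg
  rwa [hB, trace_mul_cycle, CFC.sqrt_mul_sqrt_self P hP.nonneg] at h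

theorem PosSemidef.trace_mul_mono {P Q Q' : Matrix ι ι ℝ} (hP : P.PosSemidef) (h : Q ≤ Q') :
    (P * Q).trace ≤ (P * Q').trace := by
  have := hP.trace_mul_nonneg (le_iff.mp h)
  rw [mul_sub, trace_sub] at this
  linarith

theorem posSemidef_exp {A : Matrix ι ι ℝ} (hA : IsSelfAdjoint A) : (exp A).PosSemidef :=
  nonneg_iff_posSemidef.mp hA.exp_nonneg

theorem PosSemidef.le_trace_of_mem_spectrum {P : Matrix ι ι ℝ} (hP : P.PosSemidef) {x : ℝ}
    (hx : x ∈ spectrum ℝ P) : x ≤ P.trace := by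
  rw [hP.isHermitian.spectrum_real_eq_range_eigenvalues] at hx
  obtain ⟨i, rfl⟩ := hx
  rw [hP.isHermitian.trace_eq_sum_eigenvalues]
  exact Finset.single_le_sum (f := hP.isHermitian.eigenvalues)
    (fun j _ => hP.eigenvalues_nonneg j) (Finset.mem_univ i)

theorem exp_mul_le_trace_exp {S : Matrix ι ι ℝ} (hS : IsSelfAdjoint S) {x : ℝ}
    (hx : x ∈ spectrum ℝ S) (θ : ℝ) : Real.exp (θ * x) ≤ (exp (θ • S)).trace := by
  have hθS : IsSelfAdjoint (θ • S) := (IsSelfAdjoint.all θ).smul hS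
  refine (posSemidef_exp hθS).le_trace_of_mem_spectrum ?_
  rw [← CFC.real_exp_eq_normedSpace_exp hθS, ← cfc_comp_smul θ Real.exp S,
    cfc_map_spectrum (R := ℝ) _ S]
  exact ⟨x, hx, rfl⟩

/-- The norm is attained at a spectral value of either sign, hence the two traces, which become the
factor 2 in Bernstein. -/
theorem exp_mul_norm_le [Nonempty ι] {S : Matrix ι ι ℝ} (hS : IsSelfAdjoint S) (θ : ℝ) :
    Real.exp (θ * ‖S‖) ≤ (exp (θ • S)).trace + (exp (θ • -S)).trace := by
  obtain ⟨x, hx, hxS⟩ :=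
    (IsometricContinuousFunctionalCalculus.isGreatest_norm_spectrum (𝕜 := ℝ) S).1
  have h1 := (posSemidef_exp ((IsSelfAdjoint.all θ).smul hS)).trace_nonneg
  have h2 := (posSemidef_exp ((IsSelfAdjoint.all θ).smul hS.neg)).trace_nonneg
  have hxS' : |x| = ‖S‖ := hxS
  rcases abs_choice x with h | h
  · have h3 := exp_mul_le_trace_exp hS hx θ
    rw [← hxS', h]
    linarith
  · have h3 := exp_mul_le_trace_exp hS hx (-θ)
    rw [← hxS', h]
    rw [neg_mul, neg_smul, ← smul_neg, ← mul_neg] at h3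
    linarith

/-! ### The matrix Bernstein inequality. -/

section Bernstein

variable {J : Type*} [Fintype J] {p : J → ℝ} {X : J → Matrix ι ι ℝ} {R σ θ : ℝ}

theorem sum_smul_exp_le (hp : ∀ j, 0 ≤ p j) (hp1 : ∑ j, p j = 1)
    (hX : ∀ j, IsSelfAdjoint (X j)) (hmean : ∑ j, p j • X j = 0)
    (hR : ∀ j, p j ≠ 0 → ‖X j‖ ≤ R) (hvar : ∑ j, p j • (X j * X j) ≤ σ ^ 2 • (1 : Matrix ι ι ℝ))
    (hθ : 0 ≤ θ) (hRθ : R * θ < 3) :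
    ∑ j, p j • exp (θ • X j) ≤
      (1 + θ ^ 2 / 2 / (1 - R * θ / 3) * σ ^ 2) • (1 : Matrix ι ι ℝ) := by
  set c := θ ^ 2 / 2 / (1 - R * θ / 3)
  have hc : 0 ≤ c := div_nonneg (by positivity) (by linarith)
  calc ∑ j, p j • exp (θ • X j)
      ≤ ∑ j, p j • (1 + θ • X j + c • (X j * X j)) := by
        refine Finset.sum_le_sum fun j _ => ?_
        -- The norm bound is assumed only on the support of `p`; other terms vanish.
        by_cases hj : p j = 0
        · simp [hj]
        · exact smul_le_smul_of_nonneg_left (exp_smul_le (hX j) (hR j hj) hθ hRθ) (hp j)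
    _ = (∑ j, p j) • (1 : Matrix ι ι ℝ) + θ • ∑ j, p j • X j + c • ∑ j, p j • (X j * X j) := by
        simp only [smul_add, Finset.sum_add_distrib, Finset.smul_sum, Finset.sum_smul,
          smul_comm θ, smul_comm c]
    _ ≤ (1 : Matrix ι ι ℝ) + c • (σ ^ 2 • (1 : Matrix ι ι ℝ)) := by
        rw [hp1, hmean, smul_zero, add_zero, one_smul]
        exact add_le_add_right (smul_le_smul_of_nonneg_left hvar hc) _
    _ = _ := by rw [smul_smul, add_smul, one_smul]

/-- Golden–Thompson splits off one sample; averaging over it leaves a matrix at most `b • 1`, so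
each sample costs one factor `b`. -/
theorem sum_prod_mul_trace_exp_le [Nonempty ι] (hp : ∀ j, 0 ≤ p j) (hp1 : ∑ j, p j = 1)
    (hX : ∀ j, IsSelfAdjoint (X j)) (hmean : ∑ j, p j • X j = 0)
    (hR : ∀ j, p j ≠ 0 → ‖X j‖ ≤ R) (hvar : ∑ j, p j • (X j * X j) ≤ σ ^ 2 • (1 : Matrix ι ι ℝ))
    (hθ : 0 ≤ θ) (hRθ : R * θ < 3) (m : ℕ) :
    ∑ s : Fin m → J, (∏ k, p (s k)) * (exp (θ • ∑ k, X (s k))).trace ≤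
      Fintype.card ι * (1 + θ ^ 2 / 2 / (1 - R * θ / 3) * σ ^ 2) ^ m := by
  set b := 1 + θ ^ 2 / 2 / (1 - R * θ / 3) * σ ^ 2 with hb
  have hb0 : 0 ≤ b := by
    have : 0 ≤ θ ^ 2 / 2 / (1 - R * θ / 3) := div_nonneg (by positivity) (by linarith)
    positivity
  have hW := sum_smul_exp_le hp hp1 hX hmean hR hvar hθ hRθ
  induction m with
  | zero => simp
  | succ m ih =>
    have hsum : ∀ s : Fin m → J, IsSelfAdjoint (θ • ∑ k, X (s k)) := fun s =>
      (IsSelfAdjoint.all θ).smul (isSelfAdjoint_sum _ fun k _ => hX (s k))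
    have hstep : ∀ s : Fin m → J,
        ∑ j, p j * (exp (θ • (X j + ∑ k, X (s k)))).trace ≤
          b * (exp (θ • ∑ k, X (s k))).trace := fun s => by
      set S := θ • ∑ k, X (s k)
      calc ∑ j, p j * (exp (θ • (X j + ∑ k, X (s k)))).trace
          ≤ ∑ j, p j * (exp S * exp (θ • X j)).trace := by
            refine Finset.sum_le_sum fun j _ => mul_le_mul_of_nonneg_left ?_ (hp j)
            rw [smul_add, add_comm]
            have h1 : IsSelfAdjoint (θ • X j) := (IsSelfAdjoint.all θ).smul (hX j)
            exact golden_thompson (isHermitian_iff_isSymm.mp (hsum s))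
              (isHermitian_iff_isSymm.mp h1)
        _ = (exp S * ∑ j, p j • exp (θ • X j)).trace := by
            simp [Finset.mul_sum, trace_sum, trace_smul]
        _ ≤ (exp S * b • (1 : Matrix ι ι ℝ)).trace := (posSemidef_exp (hsum s)).trace_mul_mono hW
        _ = b * (exp S).trace := by simp [trace_smul]
    calc ∑ s : Fin (m + 1) → J, (∏ k, p (s k)) * (exp (θ • ∑ k, X (s k))).trace
        = ∑ s : Fin m → J, (∏ k, p (s k)) *
            ∑ j, p j * (exp (θ • (X j + ∑ k, X (s k)))).trace := by
          rw [← (Fin.consEquiv fun _ => J).sum_comp, Fintype.sum_prod_type, Finset.sum_comm]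
          simp only [Finset.mul_sum, Fin.consEquiv_apply, Fin.prod_univ_succ, Fin.sum_univ_succ,
            Fin.cons_zero, Fin.cons_succ]
          refine Finset.sum_congr rfl fun s _ => Finset.sum_congr rfl fun j _ => by ring
      _ ≤ ∑ s : Fin m → J, (∏ k, p (s k)) * (b * (exp (θ • ∑ k, X (s k))).trace) :=
          Finset.sum_le_sum fun s _ =>
            mul_le_mul_of_nonneg_left (hstep s) (Finset.prod_nonneg fun k _ => hp (s k))
      _ = b * ∑ s : Fin m → J, (∏ k, p (s k)) * (exp (θ • ∑ k, X (s k))).trace := by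
          rw [Finset.mul_sum]
          exact Finset.sum_congr rfl fun s _ => by ring
      _ ≤ b * (Fintype.card ι * b ^ m) := mul_le_mul_of_nonneg_left ih hb0
      _ = Fintype.card ι * b ^ (m + 1) := by ring

/-- **Matrix Bernstein inequality** for sums of `m` independent copies of a centered random
symmetric matrix with finitely many values. -/
theorem bernstein [Nonempty ι] (hp : ∀ j, 0 ≤ p j) (hp1 : ∑ j, p j = 1)
    (hX : ∀ j, IsSelfAdjoint (X j)) (hmean : ∑ j, p j • X j = 0)
    (hR : ∀ j, p j ≠ 0 → ‖X j‖ ≤ R) (hvar : ∑ j, p j • (X j * X j) ≤ σ ^ 2 • (1 : Matrix ι ι ℝ))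
    (hR0 : 0 ≤ R) (hσ : 0 < σ) {ε : ℝ} (hε : 0 ≤ ε) (m : ℕ) :
    ∑ s : Fin m → J with m * ε ≤ ‖∑ k, X (s k)‖, ∏ k, p (s k) ≤
      2 * Fintype.card ι * Real.exp (-(m * (ε ^ 2 / 2 / (σ ^ 2 + R * ε / 3)))) := by
  set D := σ ^ 2 + R * ε / 3 with hD
  have hD0 : 0 < D := by positivity
  -- This choice gives `1 - Rθ/3 = σ²/D`, hence `b = 1 + ε²/(2D)`, and the exponent `-θε + ε²/(2D)`
  -- per sample is `-ε²/(2D)`.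
  set θ := ε / D with hθdef
  have hθ : 0 ≤ θ := by positivity
  have hRθ : R * θ < 3 := by
    rw [hθdef, ← mul_div_assoc, div_lt_iff₀ hD0, hD]
    nlinarith [pow_pos hσ 2]
  have hone : 1 - R * θ / 3 = σ ^ 2 / D := by
    rw [hθdef]; field_simp; rw [hD]; ring
  have hup := sum_prod_mul_trace_exp_le hp hp1 hX hmean hR hvar hθ hRθ m
  have hlow := sum_prod_mul_trace_exp_le (X := fun j => -X j) hp hp1 (fun j => (hX j).neg)
    (by simp [hmean]) (by simpa using hR) (by simpa using hvar) hθ hRθ m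
  set b := 1 + θ ^ 2 / 2 / (1 - R * θ / 3) * σ ^ 2 with hb
  have hbexp : b ≤ Real.exp (ε ^ 2 / 2 / D) := by
    have h : b = ε ^ 2 / 2 / D + 1 := by
      rw [hb, hone, hθdef]; field_simp; ring
    rw [h]
    exact Real.add_one_le_exp _
  have hb0 : 0 ≤ b := by
    rw [hb, hone]; positivity
  have hprod : ∀ s : Fin m → J, 0 ≤ ∏ k, p (s k) := fun s =>
    Finset.prod_nonneg fun k _ => hp (s k)
  have hmarkov : ∀ s : Fin m → J, m * ε ≤ ‖∑ k, X (s k)‖ →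
      ∏ k, p (s k) ≤ Real.exp (-(θ * (m * ε))) * ((∏ k, p (s k)) *
        (exp (θ • ∑ k, X (s k))).trace + (∏ k, p (s k)) * (exp (θ • ∑ k, -X (s k))).trace) := by
    intro s hs
    have h := exp_mul_norm_le (isSelfAdjoint_sum Finset.univ fun k _ => hX (s k)) θ
    have h' : Real.exp (θ * (m * ε)) ≤ (exp (θ • ∑ k, X (s k))).trace +
        (exp (θ • ∑ k, -X (s k))).trace := by
      rw [Finset.sum_neg_distrib]
      exact (Real.exp_le_exp.mpr (mul_le_mul_of_nonneg_left hs hθ)).trans h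
    calc ∏ k, p (s k) = Real.exp (-(θ * (m * ε))) * ((∏ k, p (s k)) * Real.exp (θ * (m * ε))) := by
          rw [mul_left_comm, ← Real.exp_add, neg_add_cancel, Real.exp_zero, mul_one]
      _ ≤ _ := by
          rw [← mul_add]
          gcongr
          exact hprod s
  have hterm : ∀ s : Fin m → J, 0 ≤ Real.exp (-(θ * (m * ε))) * ((∏ k, p (s k)) *
        (exp (θ • ∑ k, X (s k))).trace + (∏ k, p (s k)) * (exp (θ • ∑ k, -X (s k))).trace) := by
    intro s
    have h1 := (posSemidef_exp ((IsSelfAdjoint.all θ).smul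
      (isSelfAdjoint_sum Finset.univ fun k _ => hX (s k)))).trace_nonneg
    have h2 := (posSemidef_exp ((IsSelfAdjoint.all θ).smul
      (isSelfAdjoint_sum Finset.univ fun k _ => (hX (s k)).neg))).trace_nonneg
    have := hprod s
    positivity
  calc ∑ s : Fin m → J with m * ε ≤ ‖∑ k, X (s k)‖, ∏ k, p (s k)
      ≤ ∑ s : Fin m → J with m * ε ≤ ‖∑ k, X (s k)‖, Real.exp (-(θ * (m * ε))) *
        ((∏ k, p (s k)) * (exp (θ • ∑ k, X (s k))).trace +
          (∏ k, p (s k)) * (exp (θ • ∑ k, -X (s k))).trace) :=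
        Finset.sum_le_sum fun s hs => hmarkov s (Finset.mem_filter.mp hs).2
    _ ≤ ∑ s : Fin m → J, Real.exp (-(θ * (m * ε))) *
        ((∏ k, p (s k)) * (exp (θ • ∑ k, X (s k))).trace +
          (∏ k, p (s k)) * (exp (θ • ∑ k, -X (s k))).trace) :=
        Finset.sum_le_sum_of_subset_of_nonneg (Finset.filter_subset _ _) fun s _ _ => hterm s
    _ ≤ Real.exp (-(θ * (m * ε))) * (Fintype.card ι * b ^ m + Fintype.card ι * b ^ m) := by
        rw [← Finset.mul_sum, Finset.sum_add_distrib]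
        gcongr
    _ ≤ Real.exp (-(θ * (m * ε))) * (2 * Fintype.card ι * Real.exp (ε ^ 2 / 2 / D) ^ m) := by
        rw [← two_mul, mul_assoc 2]
        gcongr
    _ = 2 * Fintype.card ι * Real.exp (-(m * (ε ^ 2 / 2 / D))) := by
        rw [← Real.exp_nat_mul, mul_left_comm, ← Real.exp_add]
        congr 2
        rw [hθdef]; field_simp; ring

end Bernstein

end Matrix

/-! ### Hessians of generalized linear components. -/

open InnerProductSpace

namespace SubsampledHessian

section Hessian

variable {d : ℕ} {g : ℝ → ℝ} {a : EuclideanSpace ℝ (Fin d)}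

theorem inner_smul_inv_norm_sq (ha : a ≠ 0) (t : ℝ) :
    inner ℝ a (t • (‖a‖ ^ 2)⁻¹ • a) = t := by
  have : ‖a‖ ≠ 0 := norm_ne_zero_iff.mpr ha
  rw [inner_smul_right, inner_smul_right, real_inner_self_eq_norm_sq]
  field_simp

theorem gradient_comp_inner (hg : Differentiable ℝ g) (x : EuclideanSpace ℝ (Fin d)) :
    gradient (fun y => g (inner ℝ a y)) x = deriv g (inner ℝ a x) • a := by
  refine HasGradientAt.gradient ?_
  rw [hasGradientAt_iff_hasFDerivAt]
  have h := (hg (inner ℝ a x)).hasDerivAt.comp_hasFDerivAt x (innerSL ℝ a).hasFDerivAt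
  refine h.congr_fderiv ?_
  ext v
  simp

/-- The line `t ↦ t a / ‖a‖²` is a section of `⟨a, ·⟩`, so regularity of the composite passes to
`g`. -/
theorem differentiable_of_comp_inner (ha : a ≠ 0)
    (h : Differentiable ℝ fun y => g (inner ℝ a y)) : Differentiable ℝ g := by
  have hg : g = fun t : ℝ => (fun y => g (inner ℝ a y)) (t • (‖a‖ ^ 2)⁻¹ • a) := by
    funext t
    simp only [inner_smul_inv_norm_sq ha]
  rw [hg]
  exact h.comp (by fun_prop)

theorem differentiable_deriv_of_comp_inner (ha : a ≠ 0)
    (h : TwiceDifferentiable fun y => g (inner ℝ a y)) : Differentiable ℝ (deriv g) := by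
  have hg := differentiable_of_comp_inner ha h.1
  have hd : deriv g = fun t : ℝ => (‖a‖ ^ 2)⁻¹ *
      inner ℝ a (gradient (fun y => g (inner ℝ a y)) (t • (‖a‖ ^ 2)⁻¹ • a)) := by
    funext t
    have : ‖a‖ ≠ 0 := norm_ne_zero_iff.mpr ha
    rw [gradient_comp_inner hg, inner_smul_inv_norm_sq ha, inner_smul_right,
      real_inner_self_eq_norm_sq]
    field_simp
  rw [hd]
  have h2 : Differentiable ℝ fun t : ℝ =>
      gradient (fun y => g (inner ℝ a y)) (t • (‖a‖ ^ 2)⁻¹ • a) := h.2.comp (by fun_prop)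
  exact ((innerSL ℝ a).differentiable.comp h2).const_mul _

theorem hessian_comp_inner (h : TwiceDifferentiable fun y => g (inner ℝ a y))
    (x : EuclideanSpace ℝ (Fin d)) :
    hessian (fun y => g (inner ℝ a y)) x = deriv (deriv g) (inner ℝ a x) • rankOne ℝ a a := by
  -- For `a = 0` nothing is known about `g`, but both sides vanish whatever value `deriv (deriv g)`
  -- takes.
  rcases eq_or_ne a 0 with rfl | ha
  · simp [hessian]
  · have hg := differentiable_of_comp_inner ha h.1
    have hg' := differentiable_deriv_of_comp_inner ha h
    have hgrad : gradient (fun y => g (inner ℝ a y)) = fun y => deriv g (inner ℝ a y) • a :=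
      funext fun y => gradient_comp_inner hg y
    rw [hessian, hgrad]
    have h1 := ((hg' (inner ℝ a x)).hasDerivAt.comp_hasFDerivAt x
      (innerSL ℝ a).hasFDerivAt).smul_const a
    refine (HasFDerivAt.fderiv h1).trans ?_
    ext1 v
    simp [smul_smul]

theorem gradient_objective {n : ℕ} {F : Fin n → EuclideanSpace ℝ (Fin d) → ℝ}
    (hF : ∀ j, Differentiable ℝ (F j)) :
    gradient (objective F) = fun x => (1 / (n : ℝ)) • ∑ j, gradient (F j) x := by
  funext x
  have h : objective F = fun x => (1 / (n : ℝ)) * ∑ j, F j x := rfl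
  simp only [gradient]
  rw [h, fderiv_const_mul (DifferentiableAt.fun_sum fun j _ => hF j x),
    fderiv_fun_sum fun j _ => hF j x, map_smulₛₗ, map_sum]
  rfl

theorem hessian_objective {n : ℕ} {F : Fin n → EuclideanSpace ℝ (Fin d) → ℝ}
    (hF : ∀ j, TwiceDifferentiable (F j)) (x : EuclideanSpace ℝ (Fin d)) :
    hessian (objective F) x = (1 / (n : ℝ)) • ∑ j, hessian (F j) x := by
  rw [hessian, gradient_objective fun j => (hF j).1,
    fderiv_fun_const_smul (DifferentiableAt.fun_sum fun j _ => (hF j).2 x),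
    fderiv_fun_sum fun j _ => (hF j).2 x]
  rfl

theorem norm_hessian_le {f : EuclideanSpace ℝ (Fin d) → ℝ} {K : ℝ} (hK : 0 ≤ K)
    (h : ∀ x y, ‖gradient f x - gradient f y‖ ≤ K * ‖x - y‖) (x : EuclideanSpace ℝ (Fin d)) :
    ‖hessian f x‖ ≤ K := by
  have hl : LipschitzWith ⟨K, hK⟩ (gradient f) :=
    LipschitzWith.of_dist_le_mul fun x y => by
      rw [dist_eq_norm, dist_eq_norm]; exact h x y
  exact norm_fderiv_le_of_lipschitz ℝ hl

end Hessian

end SubsampledHessian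

/-! ### From matrices to operators, and from weighted sums to probabilities. -/

open InnerProductSpace MeasureTheory ProbabilityTheory

namespace Matrix

open scoped Matrix.Norms.L2Operator MatrixOrder

variable {ι J : Type*} [Fintype ι] [DecidableEq ι] [Fintype J] {p : J → ℝ}

/-- The variance is the second moment minus `A * A ≥ 0`. -/
theorem sum_smul_mul_self_sub_le {Y : J → Matrix ι ι ℝ} {A : Matrix ι ι ℝ} {σ : ℝ}
    (hp : ∀ j, 0 ≤ p j) (hp1 : ∑ j, p j = 1) (hY : ∀ j, IsSelfAdjoint (Y j))
    (hA : A = ∑ j, p j • Y j) (hσ : ∀ j, p j ≠ 0 → ‖Y j‖ ≤ σ) :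
    ∑ j, p j • ((Y j - A) * (Y j - A)) ≤ σ ^ 2 • (1 : Matrix ι ι ℝ) := by
  have hAsa : IsSelfAdjoint A := by
    rw [hA]
    exact isSelfAdjoint_sum _ fun j _ => (IsSelfAdjoint.all (p j)).smul (hY j)
  have hAA : 0 ≤ A * A := by
    have h := (posSemidef_conjTranspose_mul_self A).nonneg
    rwa [(isHermitian_iff_isSelfAdjoint.mpr hAsa).eq] at h
  calc ∑ j, p j • ((Y j - A) * (Y j - A))
      = ∑ j, p j • (Y j * Y j) - (∑ j, p j • Y j) * A - A * (∑ j, p j • Y j)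
          + (∑ j, p j) • (A * A) := by
        rw [Finset.sum_mul, Finset.mul_sum, Finset.sum_smul, ← Finset.sum_sub_distrib,
          ← Finset.sum_sub_distrib, ← Finset.sum_add_distrib]
        refine Finset.sum_congr rfl fun j _ => ?_
        rw [smul_mul_assoc, mul_smul_comm, ← smul_sub, ← smul_sub, ← smul_add]
        congr 1
        noncomm_ring
    _ = ∑ j, p j • (Y j * Y j) - A * A := by
        rw [← hA, hp1, one_smul]
        abel
    _ ≤ ∑ j, p j • (Y j * Y j) := sub_le_self _ hAA
    _ ≤ ∑ j, p j • (σ ^ 2 • (1 : Matrix ι ι ℝ)) := by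
        refine Finset.sum_le_sum fun j _ => ?_
        by_cases hj : p j = 0
        · simp [hj]
        · exact smul_le_smul_of_nonneg_left (mul_self_le_smul_one (hY j) (hσ j hj)) (hp j)
    _ = σ ^ 2 • (1 : Matrix ι ι ℝ) := by rw [← Finset.sum_smul, hp1, one_smul]

/-- **Matrix Bernstein inequality** for the empirical mean of `m` independent copies of a random
self-adjoint operator with finitely many values. -/
theorem _root_.ContinuousLinearMap.bernstein_empirical_mean [Nonempty ι]
    {Y : J → EuclideanSpace ℝ ι →L[ℝ] EuclideanSpace ℝ ι}
    {A : EuclideanSpace ℝ ι →L[ℝ] EuclideanSpace ℝ ι} {R σ : ℝ}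
    (hp : ∀ j, 0 ≤ p j) (hp1 : ∑ j, p j = 1) (hY : ∀ j, IsSelfAdjoint (Y j))
    (hA : A = ∑ j, p j • Y j) (hσ : ∀ j, p j ≠ 0 → ‖Y j‖ ≤ σ)
    (hR : ∀ j, p j ≠ 0 → ‖Y j - A‖ ≤ R) (hR0 : 0 ≤ R) (hσ0 : 0 < σ) {ε : ℝ} (hε : 0 ≤ ε)
    {m : ℕ} (hm : 0 < m) :
    ∑ s : Fin m → J with ε ≤ ‖(1 / (m : ℝ)) • ∑ k, Y (s k) - A‖, ∏ k, p (s k) ≤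
      2 * Fintype.card ι * Real.exp (-(m * (ε ^ 2 / 2 / (σ ^ 2 + R * ε / 3)))) := by
  -- An isometric star-isomorphism carries the operators to matrices.
  let Φ := (toEuclideanCLM (n := ι) (𝕜 := ℝ)).symm
  have hnorm : ∀ T, ‖Φ T‖ = ‖T‖ := fun T => by
    rw [cstar_norm_def]
    exact congrArg _ ((toEuclideanCLM (n := ι) (𝕜 := ℝ)).apply_symm_apply T)
  have hsmul : ∀ (c : ℝ) T, Φ (c • T) = c • Φ T := fun c T => map_smul Φ c T
  have hsa : ∀ j, IsSelfAdjoint (Φ (Y j)) := fun j =>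
    (Φ.map_star' (Y j)).symm.trans (congrArg Φ (hY j).star_eq)
  have hΦA : Φ A = ∑ j, p j • Φ (Y j) := by
    rw [hA, map_sum]
    simp only [hsmul]
  have hΦAsa : IsSelfAdjoint (Φ A) := by
    rw [hΦA]
    exact isSelfAdjoint_sum _ fun j _ => (IsSelfAdjoint.all (p j)).smul (hsa j)
  have hmean : ∑ j, p j • (Φ (Y j) - Φ A) = 0 := by
    simp only [smul_sub, Finset.sum_sub_distrib, ← Finset.sum_smul, hp1, one_smul, ← hΦA, sub_self]
  have hm0 : (0 : ℝ) < m := by exact_mod_cast hm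
  refine le_trans (le_of_eq ?_) (bernstein (X := fun j => Φ (Y j) - Φ A) hp hp1
    (fun j => (hsa j).sub hΦAsa) hmean
    (fun j hj => by rw [← map_sub, hnorm]; exact hR j hj)
    (sum_smul_mul_self_sub_le hp hp1 hsa hΦA fun j hj => by rw [hnorm]; exact hσ j hj)
    hR0 hσ0 hε m)
  refine Finset.sum_congr (Finset.filter_congr fun s _ => ?_) fun _ _ => rfl
  have h : ∑ k, (Φ (Y (s k)) - Φ A) = Φ ((m : ℝ) • ((1 / (m : ℝ)) • ∑ k, Y (s k) - A)) := by
    rw [smul_sub, smul_smul, mul_one_div_cancel hm0.ne', one_smul, map_sub, hsmul, map_sum,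
      Finset.sum_sub_distrib, Finset.sum_const, Finset.card_univ, Fintype.card_fin,
      Nat.cast_smul_eq_nsmul]
  rw [h, hnorm, norm_smul, Real.norm_of_nonneg hm0.le, mul_le_mul_iff_right₀ hm0]

end Matrix

/-- A union bound over sample values; independence factors each term. -/
theorem ProbabilityTheory.iIndepFun.measureReal_setOf_le_sum {Ω J : Type*} [MeasurableSpace Ω]
    {μ : Measure Ω} [IsProbabilityMeasure μ] [Fintype J] [MeasurableSpace J]
    [MeasurableSingletonClass J] {m : ℕ} {ξ : Fin m → Ω → J} (hindep : iIndepFun ξ μ) {p : J → ℝ}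
    (hlaw : ∀ k j, μ.real {ω | ξ k ω = j} = p j) (P : (Fin m → J) → Prop) [DecidablePred P] :
    μ.real {ω | P fun k => ξ k ω} ≤ ∑ s : Fin m → J with P s, ∏ k, p (s k) := by
  have hsub : {ω | P fun k => ξ k ω} ⊆
      ⋃ s ∈ Finset.univ.filter P, {ω | ∀ k, ξ k ω = s k} := fun ω hω => by
    simp only [Set.mem_iUnion]
    exact ⟨fun k => ξ k ω, Finset.mem_filter.mpr ⟨Finset.mem_univ _, hω⟩, fun _ => rfl⟩
  refine (measureReal_mono hsub (measure_ne_top μ _)).trans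
    ((measureReal_biUnion_finset_le _ _).trans (le_of_eq ?_))
  refine Finset.sum_congr rfl fun s _ => ?_
  have h := hindep.measure_inter_preimage_eq_mul Finset.univ (sets := fun k => {s k})
    fun k _ => measurableSet_singleton _
  have hset : {ω | ∀ k, ξ k ω = s k} = ⋂ k ∈ Finset.univ, ξ k ⁻¹' {s k} := by
    ext ω; simp
  rw [measureReal_def, hset, h, ENNReal.toReal_prod]
  exact Finset.prod_congr rfl fun k _ => hlaw k (s k)

/-! ### Importance sampling: mean, norm and deviation bounds. -/

namespace SubsampledHessian

variable {n d : ℕ} {g : Fin n → ℝ → ℝ} {a : Fin n → EuclideanSpace ℝ (Fin d)}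
  {x : EuclideanSpace ℝ (Fin d)}

theorem samplingProb_nonneg (g : Fin n → ℝ → ℝ) (a : Fin n → EuclideanSpace ℝ (Fin d))
    (x : EuclideanSpace ℝ (Fin d)) (j : Fin n) : 0 ≤ samplingProb g a x j :=
  div_nonneg (by positivity) (Finset.sum_nonneg fun k _ => by positivity)

theorem pMin_le {j : Fin n} (hj : secondDeriv g a x j ≠ 0) : pMin g a x ≤ samplingProb g a x j :=
  ciInf_le (f := fun j : {j : Fin n // secondDeriv g a x j ≠ 0} => samplingProb g a x j)
    (Set.finite_range _).bddBelow ⟨j, hj⟩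

theorem exists_secondDeriv_ne_zero (h : 0 < pMin g a x) : ∃ j, secondDeriv g a x j ≠ 0 := by
  by_contra! hne
  have : IsEmpty {j : Fin n // secondDeriv g a x j ≠ 0} := ⟨fun j => j.2 (hne j)⟩
  -- The real infimum of an empty family is `0`.
  rw [pMin, Real.iInf_of_isEmpty] at h
  exact h.false

theorem sum_secondDeriv_pos (h : 0 < pMin g a x) :
    0 < ∑ k, |secondDeriv g a x k| * ‖a k‖ ^ 2 := by
  obtain ⟨j, hj⟩ := exists_secondDeriv_ne_zero h
  refine (Finset.sum_nonneg fun k _ => by positivity).lt_of_ne fun h0 => ?_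
  have hpos := h.trans_le (pMin_le hj)
  rw [samplingProb, ← h0, div_zero] at hpos
  exact hpos.false

theorem sum_samplingProb (h : 0 < pMin g a x) : ∑ j, samplingProb g a x j = 1 := by
  simp only [samplingProb]
  rw [← Finset.sum_div, div_self (sum_secondDeriv_pos h).ne']

theorem secondDeriv_ne_zero {j : Fin n} (h : samplingProb g a x j ≠ 0) :
    secondDeriv g a x j ≠ 0 := fun h0 => h (by simp [samplingProb, h0])

variable {L ρ : Fin n → ℝ}

theorem hessian_glm (hF : SmoothFiniteSum (glm g a) L ρ) (x : EuclideanSpace ℝ (Fin d))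
    (j : Fin n) : hessian (glm g a j) x = secondDeriv g a x j • rankOne ℝ (a j) (a j) :=
  hessian_comp_inner (hF.component_twiceDifferentiable j) x

theorem norm_hessian_glm (hF : SmoothFiniteSum (glm g a) L ρ) (x : EuclideanSpace ℝ (Fin d))
    (j : Fin n) : ‖hessian (glm g a j) x‖ = |secondDeriv g a x j| * ‖a j‖ ^ 2 := by
  rw [hessian_glm hF, norm_smul, norm_rankOne, Real.norm_eq_abs, pow_two]

theorem norm_hessian_glm_le (hF : SmoothFiniteSum (glm g a) L ρ) (x : EuclideanSpace ℝ (Fin d))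
    (j : Fin n) : ‖hessian (glm g a j) x‖ ≤ L j :=
  norm_hessian_le (hF.L_pos j).le (hF.gradient_lipschitz j) x

theorem isSelfAdjoint_hessian_glm (hF : SmoothFiniteSum (glm g a) L ρ)
    (x : EuclideanSpace ℝ (Fin d)) (j : Fin n) : IsSelfAdjoint (hessian (glm g a j) x) := by
  rw [hessian_glm hF]
  exact (IsSelfAdjoint.all _).smul (isPositive_rankOne_self (a j)).isSelfAdjoint

theorem smul_smul_one_div_smul {V : Type*} [AddCommGroup V] [Module ℝ V] {q : ℝ} {v : V}
    (h : q = 0 → v = 0) (c : ℝ) : q • c • (1 / q) • v = c • v := by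
  by_cases hq : q = 0
  · simp [h hq]
  · rw [smul_comm, smul_smul q, mul_one_div_cancel hq, one_smul]

theorem sum_smul_hessian_glm (hF : SmoothFiniteSum (glm g a) L ρ) (h : 0 < pMin g a x) :
    ∑ j, samplingProb g a x j • (1 / (n : ℝ)) • (1 / samplingProb g a x j) • hessian (glm g a j) x =
      hessian (objective (glm g a)) x := by
  rw [hessian_objective hF.component_twiceDifferentiable, Finset.smul_sum]
  refine Finset.sum_congr rfl fun j _ => ?_
  have h0 : samplingProb g a x j = 0 → hessian (glm g a j) x = 0 := fun hj => by
    rw [← norm_eq_zero, norm_hessian_glm hF]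
    exact (div_eq_zero_iff.mp hj).resolve_right (sum_secondDeriv_pos h).ne'
  exact smul_smul_one_div_smul h0 _

theorem norm_smul_hessian_glm_le (hF : SmoothFiniteSum (glm g a) L ρ) (h : 0 < pMin g a x)
    {j : Fin n} (hj : samplingProb g a x j ≠ 0) :
    ‖(1 / (n : ℝ)) • (1 / samplingProb g a x j) • hessian (glm g a j) x‖ ≤ avgConst L := by
  have hS := sum_secondDeriv_pos h
  have hne : |secondDeriv g a x j| * ‖a j‖ ^ 2 ≠ 0 := fun h0 =>
    hj (by rw [samplingProb, h0, zero_div])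
  rw [norm_smul, norm_smul, norm_hessian_glm hF, avgConst, Real.norm_of_nonneg (by positivity),
    Real.norm_of_nonneg (one_div_nonneg.mpr (samplingProb_nonneg g a x j))]
  gcongr
  rw [samplingProb, one_div_div, div_mul_cancel₀ _ hne]
  exact Finset.sum_le_sum fun k _ => (norm_hessian_glm hF x k).symm.trans_le
    (norm_hessian_glm_le hF x k)

theorem le_maxConst (L : Fin n → ℝ) (j : Fin n) : L j ≤ maxConst L :=
  le_ciSup (Set.finite_range L).bddAbove j

/-- Cancelling the `j`-th Hessian against its copy in `∇²f(x)` leaves the weight `1/pⱼ - 1` on it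
and `n - 1` other Hessians; together these give `n + 1/p_min - 2`. -/
theorem norm_smul_hessian_glm_sub_le (hF : SmoothFiniteSum (glm g a) L ρ) (h : 0 < pMin g a x)
    {j : Fin n} (hj : samplingProb g a x j ≠ 0) :
    ‖(1 / (n : ℝ)) • (1 / samplingProb g a x j) • hessian (glm g a j) x -
        hessian (objective (glm g a)) x‖ ≤
      maxConst L * (((n : ℝ) + 1 / pMin g a x - 2) / n) := by
  have hle : ∀ k, ‖hessian (glm g a k) x‖ ≤ maxConst L := fun k =>
    (norm_hessian_glm_le hF x k).trans (le_maxConst L k)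
  have hL : 0 ≤ maxConst L := (norm_nonneg _).trans (hle j)
  have hpos : 0 < samplingProb g a x j := (samplingProb_nonneg g a x j).lt_of_ne' hj
  have hp1 : samplingProb g a x j ≤ 1 := by
    rw [← sum_samplingProb h]
    exact Finset.single_le_sum (fun k _ => samplingProb_nonneg g a x k) (Finset.mem_univ j)
  have hinv : 1 / samplingProb g a x j ≤ 1 / pMin g a x :=
    one_div_le_one_div_of_le h (pMin_le (secondDeriv_ne_zero hj))
  have h1 : 0 ≤ 1 / samplingProb g a x j - 1 := sub_nonneg.mpr ((one_le_div hpos).mpr hp1)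
  have hcard : ((Finset.univ.erase j).card : ℝ) = n - 1 := by
    rw [Finset.card_erase_of_mem (Finset.mem_univ j), Finset.card_univ, Fintype.card_fin,
      Nat.cast_pred j.pos]
  have hsplit : (1 / (n : ℝ)) • (1 / samplingProb g a x j) • hessian (glm g a j) x -
      hessian (objective (glm g a)) x = (1 / (n : ℝ)) •
        ((1 / samplingProb g a x j - 1) • hessian (glm g a j) x -
          ∑ k ∈ Finset.univ.erase j, hessian (glm g a k) x) := by
    rw [hessian_objective hF.component_twiceDifferentiable,
      ← Finset.add_sum_erase _ _ (Finset.mem_univ j)]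
    module
  rw [hsplit, norm_smul, Real.norm_of_nonneg (by positivity)]
  calc 1 / (n : ℝ) * ‖(1 / samplingProb g a x j - 1) • hessian (glm g a j) x -
          ∑ k ∈ Finset.univ.erase j, hessian (glm g a k) x‖
      ≤ 1 / (n : ℝ) * ((1 / pMin g a x - 1) * maxConst L + (n - 1) * maxConst L) := by
        gcongr
        refine (norm_sub_le _ _).trans (add_le_add ?_ ?_)
        · rw [norm_smul, Real.norm_of_nonneg h1]
          exact mul_le_mul (by linarith) (hle j) (norm_nonneg _) (by linarith)
        · refine (norm_sum_le_of_le _ fun k _ => hle k).trans (le_of_eq ?_)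
          rw [Finset.sum_const, nsmul_eq_mul, hcard]
    _ = _ := by ring

theorem mul_exp_neg_lt_of_le_sample_size {c δ ε σ R M t : ℝ} (hc : 0 < c) (hδ : 0 < δ) (hδc : δ < c) (hε : 0 < ε)
    (hσ : 0 < σ) (hR : 0 ≤ R) (hM₁ : 4 * σ ^ 2 / ε ^ 2 ≤ M) (hM₂ : 2 * R / ε ≤ M)
    (ht : M * Real.log (c / δ) ≤ t) :
    c * Real.exp (-(t * (ε ^ 2 / 2 / (σ ^ 2 + R * ε / 3)))) < δ := by
  have hlog : 0 < Real.log (c / δ) := Real.log_pos ((one_lt_div hδ).mpr hδc)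
  have hD : 0 < σ ^ 2 + R * ε / 3 := by positivity
  rw [div_le_iff₀ (by positivity)] at hM₁ hM₂
  -- The two bounds on `M` give at most `(1/4 + 1/6) M ε²`, and `5/12 < 1/2` makes the final bound
  -- strict.
  have hM : σ ^ 2 + R * ε / 3 < M * (ε ^ 2 / 2) := by
    nlinarith [pow_pos hσ 2, mul_le_mul_of_nonneg_right hM₂ hε.le]
  have hkey : Real.log (c / δ) < t * (ε ^ 2 / 2 / (σ ^ 2 + R * ε / 3)) := by
    rw [← mul_div_assoc, lt_div_iff₀ hD]
    calc Real.log (c / δ) * (σ ^ 2 + R * ε / 3) < Real.log (c / δ) * (M * (ε ^ 2 / 2)) := by gcongr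
      _ = M * Real.log (c / δ) * (ε ^ 2 / 2) := by ring
      _ ≤ t * (ε ^ 2 / 2) := by gcongr
  calc c * Real.exp (-(t * (ε ^ 2 / 2 / (σ ^ 2 + R * ε / 3))))
      < c * Real.exp (-Real.log (c / δ)) := by gcongr
    _ = δ := by
      rw [Real.exp_neg, Real.exp_log (by positivity)]
      field_simp

end SubsampledHessian

theorem lemma2 {n d m : ℕ}
    (g : Fin n → ℝ → ℝ) (a : Fin n → EuclideanSpace ℝ (Fin d)) (L ρ : Fin n → ℝ)
    (hF : SubsampledHessian.SmoothFiniteSum (SubsampledHessian.glm g a) L ρ)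
    (x : EuclideanSpace ℝ (Fin d))
    (hpmin : 0 < SubsampledHessian.pMin g a x)
    {Ω : Type*} [MeasurableSpace Ω] (μ : MeasureTheory.Measure Ω)
    [MeasureTheory.IsProbabilityMeasure μ]
    (ξ : Fin m → Ω → Fin n) (hmeas : ∀ k, Measurable (ξ k))
    (hindep : ProbabilityTheory.iIndepFun ξ μ)
    (hlaw : ∀ k j, μ.real {ω | ξ k ω = j} = SubsampledHessian.samplingProb g a x j)
    (ε δ : ℝ) (hε : 0 < ε) (hε1 : ε < 1) (hδ : 0 < δ) (hδ1 : δ < 1)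
    (hm : (m : ℝ) ≥
      max (4 * SubsampledHessian.avgConst L ^ 2 / ε ^ 2)
        (2 * SubsampledHessian.maxConst L / ε *
          (((n : ℝ) + 1 / SubsampledHessian.pMin g a x - 2) / (n : ℝ))) *
        Real.log (2 * (d : ℝ) / δ)) :
    μ.real {ω | ε ≤
      ‖SubsampledHessian.subsampledHessian (SubsampledHessian.glm g a)
          (SubsampledHessian.samplingProb g a x) (fun k => ξ k ω) x -
        SubsampledHessian.hessian
          (SubsampledHessian.objective (SubsampledHessian.glm g a)) x‖} < δ := by
  classical
  open SubsampledHessian in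
  obtain ⟨j₀, hj₀⟩ := exists_secondDeriv_ne_zero hpmin
  have hp₀ : samplingProb g a x j₀ ≠ 0 := (hpmin.trans_le (pMin_le hj₀)).ne'
  have ha₀ : a j₀ ≠ 0 := fun h0 => hp₀ (by simp [samplingProb, h0])
  -- Positivity of `p_min` yields a nonzero `aⱼ`, which forces `d ≥ 1` and `n ≥ 1`.
  have hd : 0 < d := Nat.pos_of_ne_zero fun h0 => ha₀ (by subst h0; exact Subsingleton.elim _ _)
  have hd1 : (1 : ℝ) ≤ d := by exact_mod_cast hd
  have hn : 0 < n := j₀.pos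
  have hn0 : (0 : ℝ) < n := by exact_mod_cast hn
  have : Nonempty (Fin d) := ⟨⟨0, hd⟩⟩
  have hσ : 0 < avgConst L :=
    mul_pos (by positivity) (Finset.sum_pos (fun j _ => hF.L_pos j) ⟨j₀, Finset.mem_univ _⟩)
  set R := maxConst L * (((n : ℝ) + 1 / pMin g a x - 2) / n) with hR
  have hR0 : 0 ≤ R := (norm_nonneg _).trans (norm_smul_hessian_glm_sub_le hF hpmin hp₀)
  set M := max (4 * avgConst L ^ 2 / ε ^ 2)
    (2 * maxConst L / ε * (((n : ℝ) + 1 / pMin g a x - 2) / (n : ℝ))) with hM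
  have hM₁ : 4 * avgConst L ^ 2 / ε ^ 2 ≤ M := le_max_left _ _
  have hM₂ : 2 * R / ε ≤ M := (le_of_eq (by rw [hR]; ring)).trans (le_max_right _ _)
  have hlog : 0 < Real.log (2 * (d : ℝ) / δ) :=
    Real.log_pos ((one_lt_div hδ).mpr (by linarith))
  have hm0 : 0 < m := by
    have h : (0 : ℝ) < m := lt_of_lt_of_le
      (mul_pos (lt_of_lt_of_le (by positivity) hM₁) hlog) hm
    exact_mod_cast h
  have hsub : ∀ s : Fin m → Fin n, subsampledHessian (glm g a) (samplingProb g a x) s x =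
      (1 / (m : ℝ)) • ∑ k, (1 / (n : ℝ)) • (1 / samplingProb g a x (s k)) •
        hessian (glm g a (s k)) x := fun s => by
    rw [subsampledHessian, ← Finset.smul_sum, smul_smul, one_div_mul_one_div, mul_comm (n : ℝ)]
  have hbern := ContinuousLinearMap.bernstein_empirical_mean (p := samplingProb g a x)
    (samplingProb_nonneg g a x) (sum_samplingProb hpmin)
    (fun j => (IsSelfAdjoint.all (1 / (n : ℝ))).smul
      ((IsSelfAdjoint.all (1 / samplingProb g a x j)).smul (isSelfAdjoint_hessian_glm hF x j)))
    (sum_smul_hessian_glm hF hpmin).symm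
    (fun j hj => norm_smul_hessian_glm_le hF hpmin hj)
    (fun j hj => norm_smul_hessian_glm_sub_le hF hpmin hj) hR0 hσ hε.le hm0
  rw [Fintype.card_fin] at hbern
  refine (hindep.measureReal_setOf_le_sum hlaw fun s => ε ≤
    ‖subsampledHessian (glm g a) (samplingProb g a x) s x - hessian (objective (glm g a)) x‖).trans_lt
    (lt_of_le_of_lt ?_
      (mul_exp_neg_lt_of_le_sample_size (by positivity) hδ (by linarith) hε hσ hR0 hM₁ hM₂ hm))
  simp only [hsub]
  convert hbern
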